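/- Let $T$ be a non-empty string over a finite alphabet $\Sigma$ of size $\sigma$. The empty string is regarded as occurring at all $|T|+1$ positions of $T$. A substring $w$ of $T$ is a *maximal repeat* if it occurs more than once in $T$ and every left extension $aw$ and every right extension $wa$ ($a\in\Sigma$) occurs strictly fewer times in $T$ than $w$. Let $\mu_T$, $e_T^r$ and $e_T^\ell$ be the numbers of maximal repeats $w$ of $T$, of substrings of $T$ of the form $wa$, and of substrings of $T$ of the form $aw$, respectively, with $w$ a maximal repeat and $a\in\Sigma$. For a substring $x$ of $T$, let $\overrightarrow{x}$ be the longest string with the same beginning positions in $T$ as $x$, and let $[x]_R$ be the set of strings with the same ending positions in $T$ as $x$. $\mathrm{CDAWG}(T)$ is the edge-labeled DAG with nodes $[\overrightarrow{x}]_R$, for $x$ a substring of $T$, and edges $([y]_R,\, a\beta,\, [ya\beta]_R)$ for all $y=\overrightarrow{y}$, $a\in\Sigma$ and $\beta\in\Sigma^*$ such that $ya$ is a substring of $T$ and $\overrightarrow{ya}=ya\beta$; its source is $[\varepsilon]_R$. $\mathrm{L\text{-}CDAWG}(T)=(V,E)$ is obtained from it as follows. For each node $N$ of $\mathrm{CDAWG}(T)$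 with longest member $u$ and each $a\in\Sigma$ such that $au$ is a substring of $T$: if the path from the source spelling $au$ ends strictly inside an edge, a new node (of type 2) is inserted at that point. Each edge is split at the type-2 nodes inside it, and each resulting edge stores the first character and the length of its label. **Claim.** Over a constant alphabet, $|V| = O(\mu_T + e_T^r)$ and $|E| = O(e_T^r)$. That is, for every $\sigma$ there is a constant $C$ depending only on $\sigma$ such that, for every alphabet of size $\sigma$ and every non-empty string $T$ over it, $V$ and $E$ are finite, $|V|\le C(\mu_T+e_T^r)$ and $|E|\le C\,e_T^r$. Moreover, $e_T^\ell\le\sigma e_T^r$. -/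

import Mathlib

universe u

namespace LCDAWG

/-- Beginning positions (0-based) of the occurrences of `x` in `T`.  The empty string begins at
each of the positions `0, …, |T|`. -/
def begPos {A : Type*} [DecidableEq A] (T x : List A) : Finset ℕ :=
  (Finset.range (T.length + 1)).filter fun i => x <+: T.drop i

/-- Ending positions of the occurrences of `x` in `T`: the `i` such that `x` is a suffix of the
prefix of `T` of length `i`. -/
def endPos {A : Type*} [DecidableEq A] (T x : List A) : Finset ℕ :=
  (Finset.range (T.length + 1)).filter fun i => x <:+ T.take i

/-- The number of occurrences of `x` in `T`. -/
def numOcc {A : Type*} [DecidableEq A] (T x : List A) : ℕ :=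
  (begPos T x).card

/-- `w` is a maximal repeat of `T`: it occurs more than once, and all its left extensions `aw` and
right extensions `wa` occur strictly fewer times. -/
def IsMaximalRepeat {A : Type*} [DecidableEq A] (T w : List A) : Prop :=
  1 < numOcc T w ∧
  (∀ a : A, a :: w <:+: T → numOcc T (a :: w) < numOcc T w) ∧
  (∀ a : A, w ++ [a] <:+: T → numOcc T (w ++ [a]) < numOcc T w)

/-- The number of maximal repeats of `T`. -/
noncomputable def mu {A : Type*} [DecidableEq A] (T : List A) : ℕ :=
  {w : List A | IsMaximalRepeat T w}.ncard

/-- The number of right extensions of maximal repeats of `T`. -/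
noncomputable def eRight {A : Type*} [DecidableEq A] (T : List A) : ℕ :=
  {z : List A | z <:+: T ∧ ∃ w a, IsMaximalRepeat T w ∧ z = w ++ [a]}.ncard

/-- The number of left extensions of maximal repeats of `T`. -/
noncomputable def eLeft {A : Type*} [DecidableEq A] (T : List A) : ℕ :=
  {z : List A | z <:+: T ∧ ∃ w a, IsMaximalRepeat T w ∧ z = a :: w}.ncard

/-- `y` is the longest string with the same beginning positions in `T` as the substring `x`. -/
def IsLrep {A : Type*} [DecidableEq A] (T x y : List A) : Prop :=
  x <:+: T ∧ begPos T y = begPos T x ∧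
  ∀ z : List A, begPos T z = begPos T x → z.length ≤ y.length

/-- The class of the strings with the same ending positions in `T` as `x`. -/
def Rclass {A : Type*} [DecidableEq A] (T x : List A) : Set (List A) :=
  {y | endPos T y = endPos T x}

/-- The nodes of the CDAWG of `T`. -/
def cdawgV {A : Type*} [DecidableEq A] (T : List A) : Set (Set (List A)) :=
  {N | ∃ x y : List A, IsLrep T x y ∧ N = Rclass T y}

/-- An edge of a graph whose nodes are sets of strings and whose edge labels are strings. -/
@[ext] structure CEdge (A : Type*) where
  hi : Set (List A)
  lab : List A
  lo : Set (List A)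

/-- The edges of the CDAWG of `T`.  If `y` is the longest member of its `≡_L`-class and `ya` is a
substring of `T`, there is an edge from the class of `y`, whose label starts with `a`, such that
`y` followed by the label is the longest member of the `≡_L`-class of `ya`. -/
def cdawgE {A : Type*} [DecidableEq A] (T : List A) : Set (CEdge A) :=
  {e | ∃ (x y : List A) (a : A) (β : List A), IsLrep T x y ∧
      IsLrep T (y ++ [a]) (y ++ a :: β) ∧
      e.hi = Rclass T y ∧ e.lab = a :: β ∧ e.lo = Rclass T (y ++ a :: β)}

/-- `Spells T x N`: there is a path of the CDAWG of `T` from the source to `N` that spells out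
`x`. -/
inductive Spells {A : Type*} [DecidableEq A] (T : List A) : List A → Set (List A) → Prop
  | source : Spells T [] (Rclass T [])
  | step (x : List A) (e : CEdge A) (he : e ∈ cdawgE T) (hx : Spells T x e.hi) :
      Spells T (x ++ e.lab) e.lo

/-- The path of the CDAWG of `T` from the source that spells out `s` ends strictly inside the edge
`e`, after the first `k` characters of its label. -/
def EndsInside {A : Type*} [DecidableEq A] (T s : List A) (e : CEdge A) (k : ℕ) : Prop :=
  e ∈ cdawgE T ∧ 0 < k ∧ k < e.lab.length ∧
  ∃ x : List A, Spells T x e.hi ∧ s = x ++ e.lab.take k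

/-- `u` is the value (the longest member) of the node `N`. -/
def IsValue {A : Type*} (N : Set (List A)) (u : List A) : Prop :=
  u ∈ N ∧ ∀ v ∈ N, v.length ≤ u.length

/-- There is a type-2 node inside the edge `e` after the first `k` characters of its label: the
path that spells out some substring `au` of `T`, where `u` is the value of a CDAWG node, ends
there. -/
def IsType2 {A : Type*} [DecidableEq A] (T : List A) (e : CEdge A) (k : ℕ) : Prop :=
  ∃ N ∈ cdawgV T, ∃ (u : List A) (a : A),
    IsValue N u ∧ a :: u <:+: T ∧ EndsInside T (a :: u) e k

/-- Nodes of the L-CDAWG: a node of the CDAWG (type 1), or a point inside an edge of the CDAWG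
(type 2). -/
inductive LNode (A : Type*)
  | type1 (N : Set (List A)) : LNode A
  | type2 (e : CEdge A) (k : ℕ) : LNode A

/-- The node set of the L-CDAWG of `T`. -/
def V {A : Type*} [DecidableEq A] (T : List A) : Set (LNode A) :=
  {v | (∃ N ∈ cdawgV T, v = LNode.type1 N) ∨ ∃ e k, IsType2 T e k ∧ v = LNode.type2 e k}

/-- An edge of the L-CDAWG: its end points, the first character of its original label, and the
length of that label. -/
@[ext] structure LEdge (A : Type*) where
  hi : LNode A
  char : A
  slen : ℕ
  lo : LNode A

/-- `IsPoint T e k v`: `v` is the L-CDAWG node on the CDAWG edge `e` after the first `k` characters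
of its label. -/
def IsPoint {A : Type*} [DecidableEq A] (T : List A) (e : CEdge A) (k : ℕ) (v : LNode A) : Prop :=
  (k = 0 ∧ v = LNode.type1 e.hi) ∨
  (k = e.lab.length ∧ v = LNode.type1 e.lo) ∨
  (IsType2 T e k ∧ v = LNode.type2 e k)

/-- The edge set of the L-CDAWG of `T`: each CDAWG edge is split at the type-2 nodes inside it, and
an edge joins any two consecutive nodes on it. -/
def E {A : Type*} [DecidableEq A] (T : List A) : Set (LEdge A) :=
  {f | ∃ e ∈ cdawgE T, ∃ i j : ℕ, i < j ∧
      IsPoint T e i f.hi ∧ IsPoint T e j f.lo ∧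
      (∀ k v, i < k → k < j → ¬ IsPoint T e k v) ∧
      e.lab[i]? = some f.char ∧ f.slen = j - i}

end LCDAWG

namespace LCDAWG

/-! Everything is counted by injections into maximal repeats and their one-letter extensions. The
value of a CDAWG node is `T` or a maximal repeat (`IsValue.eq_or_isMaximalRepeat`), so there are at
most `mu T + 1` nodes. A CDAWG edge is determined by its upper node and first letter
(`cdawgE_unique`), so it is charged to a right extension of the value of that node.

A type-2 node is charged to the left extension whose path ends there. This is injective because
paths are determined by what they spell (`EndsInside.unique`): strings spelled up to a node are
right-maximal, strings ending strictly inside an edge are not. An L-CDAWG edge is charged to its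
upper end on a CDAWG edge, which is the start of that edge or a type-2 node, so there are at most
`eRight T + eLeft T` of them.

Finally, every maximal repeat has a right extension in `T`, whence `eLeft T ≤ σ * mu T ≤ σ * eRight
T`. -/

/-- A set is no larger than a finite set `t` if its members can be related to members of `t` by a
relation that is injective. -/
theorem finite_and_ncard_le_of_rel {α β : Type*} {s : Set α} {t : Set β} (R : α → β → Prop)
    (ht : t.Finite) (hR : ∀ x ∈ s, ∃ y ∈ t, R x y)
    (hinj : ∀ x ∈ s, ∀ x' ∈ s, ∀ y, R x y → R x' y → x = x') :
    s.Finite ∧ s.ncard ≤ t.ncard := by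
  classical
  rcases s.eq_empty_or_nonempty with rfl | ⟨x₀, hx₀⟩
  · simp
  have : Nonempty β := (hR x₀ hx₀).nonempty
  choose! f hft hfR using hR
  have hmaps : Set.MapsTo f s t := fun x hx => hft x hx
  have hinjOn : Set.InjOn f s := fun x hx x' hx' h =>
    hinj x hx x' hx' (f x) (hfR x hx) (h ▸ hfR x' hx')
  exact ⟨Set.Finite.of_injOn hmaps hinjOn ht, Set.ncard_le_ncard_of_injOn f hmaps hinjOn ht⟩

/-! ### Occurrences, maximal repeats and their extensions -/

section Strings

variable {A : Type*} [DecidableEq A] {T : List A}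

theorem mem_begPos {x : List A} {i : ℕ} :
    i ∈ begPos T x ↔ ∃ p s, T = p ++ (x ++ s) ∧ p.length = i := by
  simp only [begPos, Finset.mem_filter, Finset.mem_range]
  constructor
  · rintro ⟨hi, s, hs⟩
    exact ⟨T.take i, s, by rw [hs, List.take_append_drop], by simp; omega⟩
  · rintro ⟨p, s, rfl, rfl⟩
    exact ⟨by simp, s, by simp⟩

theorem mem_endPos {x : List A} {i : ℕ} :
    i ∈ endPos T x ↔ ∃ p s, T = p ++ (x ++ s) ∧ p.length + x.length = i := by
  simp only [endPos, Finset.mem_filter, Finset.mem_range]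
  constructor
  · rintro ⟨hi, p, hp⟩
    refine ⟨p, T.drop i, by rw [← List.append_assoc, hp, List.take_append_drop], ?_⟩
    have := congrArg List.length hp
    simp at this
    omega
  · rintro ⟨p, s, rfl, rfl⟩
    refine ⟨by simp, p, ?_⟩
    rw [← List.append_assoc, List.take_left' (by simp)]

theorem endPos_eq_image_begPos (x : List A) :
    endPos T x = (begPos T x).image (· + x.length) := by
  ext i
  simp only [mem_endPos, Finset.mem_image, mem_begPos]
  constructor
  · rintro ⟨p, s, h, rfl⟩
    exact ⟨_, ⟨p, s, h, rfl⟩, rfl⟩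
  · rintro ⟨_, ⟨p, s, h, rfl⟩, rfl⟩
    exact ⟨p, s, h, rfl⟩

theorem card_endPos (x : List A) : (endPos T x).card = numOcc T x := by
  rw [endPos_eq_image_begPos, Finset.card_image_of_injective _ (add_left_injective _), numOcc]

theorem numOcc_congr {x y : List A} (h : endPos T x = endPos T y) : numOcc T x = numOcc T y := by
  rw [← card_endPos, ← card_endPos, h]

theorem infix_iff_begPos {x : List A} : x <:+: T ↔ (begPos T x).Nonempty := by
  constructor
  · rintro ⟨p, s, rfl⟩
    exact ⟨p.length, mem_begPos.2 ⟨p, s, by simp, rfl⟩⟩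
  · rintro ⟨i, hi⟩
    obtain ⟨p, s, rfl, -⟩ := mem_begPos.1 hi
    exact ⟨p, s, by simp⟩

theorem infix_iff_endPos {x : List A} : x <:+: T ↔ (endPos T x).Nonempty := by
  rw [infix_iff_begPos, endPos_eq_image_begPos, Finset.image_nonempty]

theorem infix_iff_numOcc_pos {x : List A} : x <:+: T ↔ 0 < numOcc T x := by
  rw [infix_iff_begPos, numOcc, Finset.card_pos]

theorem begPos_append_subset (x y : List A) : begPos T (x ++ y) ⊆ begPos T x := by
  intro i hi
  obtain ⟨p, s, h, rfl⟩ := mem_begPos.1 hi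
  exact mem_begPos.2 ⟨p, y ++ s, by simpa using h, rfl⟩

theorem endPos_append_subset (x y : List A) : endPos T (x ++ y) ⊆ endPos T y := by
  intro i hi
  obtain ⟨p, s, h, rfl⟩ := mem_endPos.1 hi
  exact mem_endPos.2 ⟨p ++ x, s, by simpa using h, by simp; omega⟩

theorem mem_endPos_append {x y : List A} {i : ℕ} :
    i ∈ endPos T (x ++ y) ↔
      ∃ p s, T = p ++ (y ++ s) ∧ p.length + y.length = i ∧ p.length ∈ endPos T x := by
  rw [mem_endPos]
  constructor
  · rintro ⟨p, s, h, rfl⟩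
    exact ⟨p ++ x, s, by simpa using h, by simp; omega,
      mem_endPos.2 ⟨p, y ++ s, by simpa using h, by simp⟩⟩
  · rintro ⟨p, s, h, rfl, hp⟩
    obtain ⟨q, r, h', hq⟩ := mem_endPos.1 hp
    have hpq : p = q ++ x := by
      rw [h, ← List.append_assoc q] at h'
      exact (List.append_inj h' (by simp [hq])).1
    subst hpq
    exact ⟨q, s, by simpa using h, by simp; omega⟩

/-- Where `x ++ y` ends depends on `x` only through the end positions of `x`. This right invariance
lets one member of a node replace another when a label is read. -/
theorem endPos_append_congr {x x' : List A} (h : endPos T x = endPos T x') (y : List A) :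
    endPos T (x ++ y) = endPos T (x' ++ y) := by
  ext i
  rw [mem_endPos_append, mem_endPos_append, h]

theorem eq_of_mem_begPos {x y : List A} {i : ℕ} (hx : i ∈ begPos T x) (hy : i ∈ begPos T y)
    (h : x.length = y.length) : x = y := by
  obtain ⟨p, s, hT, rfl⟩ := mem_begPos.1 hx
  obtain ⟨q, t, hT', hq⟩ := mem_begPos.1 hy
  rw [hT] at hT'
  exact (List.append_inj (List.append_inj hT' hq.symm).2 h).1

theorem eq_of_mem_endPos {x y : List A} {i : ℕ} (hx : i ∈ endPos T x) (hy : i ∈ endPos T y)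
    (h : x.length = y.length) : x = y := by
  obtain ⟨p, s, hT, hp⟩ := mem_endPos.1 hx
  obtain ⟨q, t, hT', hq⟩ := mem_endPos.1 hy
  rw [hT] at hT'
  exact (List.append_inj (List.append_inj hT' (by omega)).2 h).1

theorem finite_infix (T : List A) : {x : List A | x <:+: T}.Finite :=
  (T.sublists.toFinset.finite_toSet).subset fun x (hx : x <:+: T) => by
    simpa using hx.sublist

theorem IsMaximalRepeat.isInfix {w : List A} (h : IsMaximalRepeat T w) : w <:+: T :=
  infix_iff_numOcc_pos.2 (zero_lt_one.trans h.1)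

theorem finite_isMaximalRepeat (T : List A) : {w : List A | IsMaximalRepeat T w}.Finite :=
  (finite_infix T).subset fun _ h => IsMaximalRepeat.isInfix h

theorem isMaximalRepeat_nil (hT : T ≠ []) : IsMaximalRepeat T [] := by
  have hlen : 0 < T.length := List.length_pos_iff.2 hT
  have h0 : numOcc T [] = T.length + 1 := by simp [numOcc, begPos]
  -- No letter begins at position `|T|`, but the empty string does. Since `[a]` is both the left and
  -- the right extension of `[]`, one bound serves for both.
  have h1 (a : A) : numOcc T [a] < numOcc T [] := by
    refine Finset.card_lt_card ⟨begPos_append_subset [] [a], fun hsub => ?_⟩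
    have hmem : T.length ∈ begPos T ([] : List A) := mem_begPos.2 ⟨T, [], by simp, rfl⟩
    obtain ⟨p, s, h, hp⟩ := mem_begPos.1 (hsub hmem)
    have := congrArg List.length h
    simp at this
    omega
  exact ⟨by omega, fun a _ => h1 a, fun a _ => h1 a⟩

theorem endPos_self : endPos T T = {T.length} := by
  ext i
  rw [mem_endPos, Finset.mem_singleton]
  constructor
  · rintro ⟨p, s, h, rfl⟩
    have := congrArg List.length h
    simp at this
    omega
  · rintro rfl
    exact ⟨[], [], by simp, by simp⟩

/-- An occurrence that is not at the end of the text has a right extension. -/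
theorem exists_append_infix {x : List A} {i : ℕ} (hi : i ∈ endPos T x) (hne : i ≠ T.length) :
    ∃ a, x ++ [a] <:+: T := by
  obtain ⟨p, s, h, rfl⟩ := mem_endPos.1 hi
  cases s with
  | nil => exact absurd (by rw [h]; simp) hne
  | cons a s => exact ⟨a, p, s, by rw [h]; simp⟩

/-- Of two occurrences, at most one ends at the end of the text. -/
theorem IsMaximalRepeat.exists_append_infix {w : List A} (h : IsMaximalRepeat T w) :
    ∃ a, w ++ [a] <:+: T := by
  have h1 : 1 < (endPos T w).card := by rw [card_endPos]; exact h.1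
  obtain ⟨i, hi, hne⟩ := Finset.exists_mem_ne h1 T.length
  exact LCDAWG.exists_append_infix hi hne

theorem mu_le_eRight (T : List A) : mu T ≤ eRight T := by
  refine (finite_and_ncard_le_of_rel (fun w z => ∃ a, z = w ++ [a])
    ((finite_infix T).subset fun z hz => hz.1) ?_ ?_).2
  · intro w hw
    obtain ⟨a, ha⟩ := IsMaximalRepeat.exists_append_infix hw
    exact ⟨w ++ [a], ⟨ha, w, a, hw, rfl⟩, a, rfl⟩
  · rintro w - w' - _ ⟨a, rfl⟩ ⟨b, h⟩
    exact (List.append_inj' h rfl).1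

theorem one_le_mu (hT : T ≠ []) : 1 ≤ mu T :=
  (Set.ncard_pos (finite_isMaximalRepeat T)).2 ⟨[], isMaximalRepeat_nil hT⟩

theorem eLeft_le_card_mul_mu [Fintype A] (T : List A) : eLeft T ≤ Fintype.card A * mu T := by
  have hfin := Set.finite_univ (α := A) |>.prod (finite_isMaximalRepeat T)
  refine (finite_and_ncard_le_of_rel (fun z (q : A × List A) => z = q.1 :: q.2) hfin ?_ ?_).2.trans
    (by rw [Set.ncard_prod, Set.ncard_univ, Nat.card_eq_fintype_card, mu])
  · rintro z ⟨-, w, a, hw, rfl⟩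
    exact ⟨(a, w), ⟨Set.mem_univ _, hw⟩, rfl⟩
  · rintro z - z' - q rfl rfl
    rfl

end Strings

/-! ### Values of the CDAWG nodes -/

section Nodes

variable {A : Type*} [DecidableEq A] {T : List A}

/-- Every right extension of `x` occurs fewer times than `x`. -/
def RightMaximal (T x : List A) : Prop := ∀ a : A, numOcc T (x ++ [a]) < numOcc T x

theorem RightMaximal.congr {x y : List A} (hx : RightMaximal T x)
    (h : endPos T x = endPos T y) : RightMaximal T y := fun a => by
  rw [← numOcc_congr h, ← numOcc_congr (endPos_append_congr h [a])]
  exact hx a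

theorem IsLrep.isInfix {x y : List A} (h : IsLrep T x y) : y <:+: T := by
  rw [infix_iff_begPos, h.2.1, ← infix_iff_begPos]
  exact h.1

/-- If `y ++ [a]` occurred as often as `y`, it would have the same beginning positions and be
longer. -/
theorem IsLrep.rightMaximal {x y : List A} (h : IsLrep T x y) : RightMaximal T y := fun a => by
  refine Finset.card_lt_card ((begPos_append_subset y [a]).ssubset_of_ne fun heq => ?_)
  have := h.2.2 (y ++ [a]) (heq.trans h.2.1)
  simp at this

theorem exists_isValue {y : List A} (hy : y <:+: T) : ∃ u, IsValue (Rclass T y) u := by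
  have hfin : (Rclass T y).Finite := (finite_infix T).subset fun z hz => by
    rw [Set.mem_ofPred_eq, infix_iff_endPos, show endPos T z = endPos T y from hz,
      ← infix_iff_endPos]
    exact hy
  obtain ⟨u, hu, hmax⟩ := hfin.exists_maximalFor List.length _ ⟨y, rfl⟩
  exact ⟨u, hu, fun v hv => (le_total v.length u.length).elim id (hmax hv)⟩

theorem rclass_eq_of_mem {x y : List A} (h : x ∈ Rclass T y) : Rclass T y = Rclass T x := by
  ext z
  change endPos T z = endPos T y ↔ endPos T z = endPos T x
  rw [show endPos T x = endPos T y from h]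

theorem eq_rclass_of_isValue {N : Set (List A)} {u : List A} (hN : N ∈ cdawgV T)
    (hu : IsValue N u) : N = Rclass T u := by
  obtain ⟨x, y, -, rfl⟩ := hN
  exact rclass_eq_of_mem hu.1

theorem exists_isValue_of_mem_cdawgV {N : Set (List A)} (hN : N ∈ cdawgV T) :
    ∃ u, IsValue N u := by
  obtain ⟨x, y, h, rfl⟩ := hN
  exact exists_isValue h.isInfix

/-- The value of a node is the text itself or a maximal repeat. -/
theorem IsValue.eq_or_isMaximalRepeat {N : Set (List A)} {u : List A} (hN : N ∈ cdawgV T)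
    (hu : IsValue N u) : u = T ∨ IsMaximalRepeat T u := by
  obtain ⟨x, y, h, rfl⟩ := hN
  have hend : endPos T u = endPos T y := hu.1
  have hright : RightMaximal T u := h.rightMaximal.congr hend.symm
  have hinf : u <:+: T := by
    rw [infix_iff_endPos, hend, ← infix_iff_endPos]
    exact h.isInfix
  rcases Nat.lt_or_ge 1 (numOcc T u) with h1 | h1
  · refine Or.inr ⟨h1, fun a _ => ?_, fun a _ => hright a⟩
    rw [← card_endPos, ← card_endPos]
    -- With equal end positions, `a :: u` would be a member of the node longer than its value.
    refine Finset.card_lt_card ((endPos_append_subset [a] u).ssubset_of_ne fun heq => ?_)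
    have := hu.2 (a :: u) (heq.trans hend)
    simp at this
  · left
    -- A single right-maximal occurrence must end the text: otherwise some right extension would
    -- occur, yet less than once. So `T` lies in the same class, and the longest member is `T`.
    have hlast : ∀ i ∈ endPos T u, i = T.length := fun i hi => by
      by_contra hne
      obtain ⟨a, ha⟩ := exists_append_infix hi hne
      have := infix_iff_numOcc_pos.1 ha
      have := hright a
      omega
    have hself : endPos T T = endPos T u := by
      rw [endPos_self, eq_comm, Finset.eq_singleton_iff_nonempty_unique_mem]
      exact ⟨infix_iff_endPos.1 hinf, hlast⟩
    exact hinf.eq_of_length (le_antisymm hinf.length_le (hu.2 T (hself.trans hend)))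

/-- The exceptional value `T` has no extension inside `T`; hence type-2 nodes, and likewise edges,
are charged without an additive term. -/
theorem IsValue.isMaximalRepeat_of_cons {N : Set (List A)} {u : List A} {a : A}
    (hN : N ∈ cdawgV T) (hu : IsValue N u) (ha : a :: u <:+: T) : IsMaximalRepeat T u := by
  refine (hu.eq_or_isMaximalRepeat hN).resolve_left ?_
  rintro rfl
  simpa using ha.length_le

theorem IsValue.isMaximalRepeat_of_append {N : Set (List A)} {u : List A} {a : A}
    (hN : N ∈ cdawgV T) (hu : IsValue N u) (ha : u ++ [a] <:+: T) : IsMaximalRepeat T u := by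
  refine (hu.eq_or_isMaximalRepeat hN).resolve_left ?_
  rintro rfl
  simpa using ha.length_le

theorem cdawgV_finite_ncard_le (T : List A) :
    (cdawgV T).Finite ∧ (cdawgV T).ncard ≤ mu T + 1 := by
  have hfin := finite_isMaximalRepeat T
  obtain ⟨h1, h2⟩ := finite_and_ncard_le_of_rel (s := cdawgV T)
    (t := insert T {w | IsMaximalRepeat T w}) IsValue (hfin.insert T)
    (fun N hN => (exists_isValue_of_mem_cdawgV hN).imp fun u hu =>
      ⟨hu.eq_or_isMaximalRepeat hN, hu⟩)
    (fun N hN N' hN' u hu hu' =>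
      (eq_rclass_of_isValue hN hu).trans (eq_rclass_of_isValue hN' hu').symm)
  exact ⟨h1, h2.trans (Set.ncard_insert_le _ _)⟩

end Nodes

/-! ### Determinism of the CDAWG edges -/

section Edges

variable {A : Type*} [DecidableEq A] {T : List A}

/-- Replacing `y'` by `y` preserves numbers of occurrences but not beginning positions. The
positions of `y ++ a :: β'` are recovered from an inclusion with equal cardinality; then the
maximality of `y ++ a :: β` applies. -/
theorem length_le_of_isLrep {y y' β β' : List A} {a : A} (hy : endPos T y = endPos T y')
    (h : IsLrep T (y ++ [a]) (y ++ a :: β)) (h' : IsLrep T (y' ++ [a]) (y' ++ a :: β')) :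
    β'.length ≤ β.length := by
  have hcard : numOcc T (y ++ a :: β') = numOcc T (y ++ [a]) := by
    rw [numOcc_congr (endPos_append_congr hy _), numOcc_congr (endPos_append_congr hy _),
      numOcc, h'.2.1, numOcc]
  have hsub : begPos T (y ++ a :: β') ⊆ begPos T (y ++ [a]) := by
    simpa using begPos_append_subset (T := T) (y ++ [a]) β'
  have := h.2.2 _ (Finset.eq_of_subset_of_card_le hsub hcard.ge)
  simpa using this

theorem label_unique {y y' β β' : List A} {a : A} (hy : endPos T y = endPos T y')
    (h : IsLrep T (y ++ [a]) (y ++ a :: β)) (h' : IsLrep T (y' ++ [a]) (y' ++ a :: β')) :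
    β = β' := by
  have hlen : β.length = β'.length :=
    le_antisymm (length_le_of_isLrep hy.symm h' h) (length_le_of_isLrep hy h h')
  have hcard : numOcc T (y ++ a :: β') = numOcc T (y ++ [a]) := by
    rw [numOcc_congr (endPos_append_congr hy _), numOcc_congr (endPos_append_congr hy _),
      numOcc, h'.2.1, numOcc]
  have hsub : begPos T (y ++ a :: β') ⊆ begPos T (y ++ [a]) := by
    simpa using begPos_append_subset (T := T) (y ++ [a]) β'
  have heq := Finset.eq_of_subset_of_card_le hsub hcard.ge
  -- Two strings of equal length beginning at a common position of `T` coincide.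
  obtain ⟨i, hi⟩ := infix_iff_begPos.1 h.1
  have := eq_of_mem_begPos (h.2.1 ▸ hi : i ∈ begPos T (y ++ a :: β))
    (heq ▸ hi : i ∈ begPos T (y ++ a :: β')) (by simp [hlen])
  simpa using this

/-- An edge is determined by its upper node and the first character of its label. -/
theorem cdawgE_unique {e e' : CEdge A} (he : e ∈ cdawgE T) (he' : e' ∈ cdawgE T)
    (hhi : e.hi = e'.hi) (hlab : e.lab[0]? = e'.lab[0]?) : e = e' := by
  obtain ⟨x, y, a, β, -, h2, h3, h4, h5⟩ := he
  obtain ⟨x', y', a', β', -, h2', h3', h4', h5'⟩ := he'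
  have hy : endPos T y = endPos T y' := by
    have : y ∈ Rclass T y' := by
      rw [← h3', ← hhi, h3]
      rfl
    exact this
  have ha : a = a' := by simpa [h4, h4'] using hlab
  subst ha
  have hβ := label_unique hy h2 h2'
  subst hβ
  have hlo : Rclass T (y ++ a :: β) = Rclass T (y' ++ a :: β) :=
    rclass_eq_of_mem (endPos_append_congr hy _).symm
  exact CEdge.ext hhi (h4.trans h4'.symm) (by rw [h5, h5', hlo])

theorem hi_mem_cdawgV {e : CEdge A} (he : e ∈ cdawgE T) : e.hi ∈ cdawgV T := by
  obtain ⟨x, y, a, β, h1, -, h3, -⟩ := he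
  exact ⟨x, y, h1, h3⟩

theorem lab_length_pos {e : CEdge A} (he : e ∈ cdawgE T) : 0 < e.lab.length := by
  obtain ⟨x, y, a, β, -, -, -, h4, -⟩ := he
  simp [h4]

theorem cdawgE_finite_ncard_le (T : List A) :
    (cdawgE T).Finite ∧ (cdawgE T).ncard ≤ eRight T := by
  refine finite_and_ncard_le_of_rel
    (fun (e : CEdge A) z => ∃ u a, IsValue e.hi u ∧ e.lab[0]? = some a ∧ z = u ++ [a])
    ((finite_infix T).subset fun z hz => hz.1) ?_ ?_
  · intro e he
    have hV := hi_mem_cdawgV he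
    obtain ⟨u, hu⟩ := exists_isValue_of_mem_cdawgV hV
    obtain ⟨x, y, a, β, h1, h2, h3, h4, -⟩ := he
    have huy : endPos T u = endPos T y := by
      have := hu.1
      rw [h3] at this
      exact this
    have hinf : u ++ [a] <:+: T := by
      rw [infix_iff_endPos, endPos_append_congr huy, ← infix_iff_endPos]
      exact h2.1
    exact ⟨u ++ [a], ⟨hinf, u, a, hu.isMaximalRepeat_of_append hV hinf, rfl⟩, u, a, hu,
      by simp [h4], rfl⟩
  · rintro e he e' he' _ ⟨u, a, hu, ha, rfl⟩ ⟨u', a', hu', ha', h⟩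
    obtain ⟨rfl, h⟩ := List.append_inj' h rfl
    obtain rfl : a = a' := by simpa using h
    exact cdawgE_unique he he' ((eq_rclass_of_isValue (hi_mem_cdawgV he) hu).trans
      (eq_rclass_of_isValue (hi_mem_cdawgV he') hu').symm) (ha.trans ha'.symm)

/-! ### Paths from the source and type-2 nodes -/

theorem Spells.mem_and_rightMaximal {x : List A} {N : Set (List A)} (hT : T ≠ [])
    (h : Spells T x N) : N = Rclass T x ∧ RightMaximal T x := by
  induction h with
  | source =>
    refine ⟨rfl, fun a => ?_⟩
    by_cases ha : [a] <:+: T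
    · exact (isMaximalRepeat_nil hT).2.2 a ha
    · have h1 : numOcc T ([] ++ [a]) = 0 := by
        by_contra h0
        exact ha (infix_iff_numOcc_pos.2 (Nat.pos_of_ne_zero h0))
      have := (isMaximalRepeat_nil hT).1
      omega
  | step x e he _ ih =>
    obtain ⟨_, y, a, β, h1, h2, h3, h4, h5⟩ := he
    -- The edge may come from a representative `y` other than the spelled string `x`; equal end
    -- positions transfer its properties.
    have hy : endPos T y = endPos T x := by
      have : y ∈ Rclass T x := by
        rw [← ih.1, h3]
        rfl
      exact this
    have hy' := endPos_append_congr hy (a :: β)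
    rw [h4, h5]
    exact ⟨rclass_eq_of_mem hy'.symm, h2.rightMaximal.congr hy'⟩

/-- A string that ends strictly inside an edge occurs as often as the string at the end of the
edge does, so that it is not right-maximal. -/
theorem not_rightMaximal_of_inside {e : CEdge A} (he : e ∈ cdawgE T) {x : List A}
    (hx : e.hi = Rclass T x) {k : ℕ} (h0 : 0 < k) (hk : k < e.lab.length) :
    ¬ RightMaximal T (x ++ e.lab.take k) := by
  obtain ⟨_, y, a, β, h1, h2, h3, h4, h5⟩ := he
  have hy : endPos T y = endPos T x := by
    have : y ∈ Rclass T x := by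
      rw [← hx, h3]
      rfl
    exact this
  intro hmax
  -- The next letter of the label refutes right-maximality. Writing `#` for `numOcc T` and `l` for
  -- the label, it would give `#(y l) ≤ #(y l[..k+1]) < #(y l[..k]) ≤ #(y a) = #(y l)`.
  have hmax' := hmax.congr (endPos_append_congr hy.symm _) (e.lab[k])
  rw [List.append_assoc, List.take_append_getElem hk] at hmax'
  have hle1 : numOcc T (y ++ e.lab) ≤ numOcc T (y ++ e.lab.take (k + 1)) := by
    have := begPos_append_subset (T := T) (y ++ e.lab.take (k + 1)) (e.lab.drop (k + 1))
    rw [List.append_assoc, List.take_append_drop] at this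
    exact Finset.card_le_card this
  have hle2 : numOcc T (y ++ e.lab.take k) ≤ numOcc T (y ++ [a]) := by
    obtain ⟨k, rfl⟩ : ∃ m, k = m + 1 := ⟨k - 1, by omega⟩
    have := begPos_append_subset (T := T) (y ++ [a]) (β.take k)
    rw [h4, List.take_succ_cons]
    exact Finset.card_le_card (by simpa using this)
  have heq : numOcc T (y ++ e.lab) = numOcc T (y ++ [a]) := by
    rw [h4, numOcc, h2.2.1, numOcc]
  omega

/-- Were `x'` longer than `x`, it would end strictly inside `e`, although a string spelled up to a
node is right-maximal. -/
theorem EndsInside.length_le {s x x' : List A} {e e' : CEdge A} {k k' : ℕ} (hT : T ≠ [])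
    (he : e ∈ cdawgE T) (hk : k < e.lab.length)
    (hx : Spells T x e.hi) (hs : s = x ++ e.lab.take k)
    (hx' : Spells T x' e'.hi) (hs' : s = x' ++ e'.lab.take k') :
    x'.length ≤ x.length := by
  by_contra! hlt
  have hpre : x <+: x' :=
    List.prefix_of_prefix_length_le ⟨_, hs.symm⟩ ⟨_, hs'.symm⟩ hlt.le
  obtain ⟨t, rfl⟩ := hpre
  rw [hs, List.append_assoc] at hs'
  have htake : t <+: e.lab.take k := ⟨_, (List.append_cancel_left hs').symm⟩
  have ht0 : 0 < t.length := by simpa using hlt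
  have htk : t.length ≤ k := htake.length_le.trans (List.length_take_le _ _)
  have ht : t = e.lab.take t.length :=
    List.prefix_iff_eq_take.1 (htake.trans (List.take_prefix _ _))
  have hmax := (hx'.mem_and_rightMaximal hT).2
  rw [ht] at hmax
  exact not_rightMaximal_of_inside he (hx.mem_and_rightMaximal hT).1 ht0 (htk.trans_lt hk) hmax

/-- A path is determined by the string that it spells. -/
theorem EndsInside.unique {s : List A} {e e' : CEdge A} {k k' : ℕ} (hT : T ≠ [])
    (h : EndsInside T s e k) (h' : EndsInside T s e' k') : e = e' ∧ k = k' := by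
  obtain ⟨he, h0, hk, x, hx, hs⟩ := h
  obtain ⟨he', h0', hk', x', hx', hs'⟩ := h'
  have hlen : x.length = x'.length := le_antisymm
    (length_le hT he' hk' hx' hs' hx hs) (length_le hT he hk hx hs hx' hs')
  obtain ⟨rfl, htake⟩ := List.append_inj (hs.symm.trans hs') hlen
  have hkk : k = k' := by
    have := congrArg List.length htake
    simp at this
    omega
  subst hkk
  refine ⟨cdawgE_unique he he' ?_ ?_, rfl⟩
  · rw [(hx.mem_and_rightMaximal hT).1, (hx'.mem_and_rightMaximal hT).1]
  · have := congrArg (fun l : List A => l[0]?) htake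
    simpa [List.getElem?_take, h0] using this

theorem isType2_finite_ncard_le (hT : T ≠ []) :
    {q : CEdge A × ℕ | IsType2 T q.1 q.2}.Finite ∧
      {q : CEdge A × ℕ | IsType2 T q.1 q.2}.ncard ≤ eLeft T := by
  refine finite_and_ncard_le_of_rel (fun q z => EndsInside T z q.1 q.2)
    ((finite_infix T).subset fun z hz => hz.1) ?_ ?_
  · rintro ⟨e, k⟩ ⟨N, hN, u, a, hu, hau, hend⟩
    exact ⟨a :: u, ⟨hau, u, a, hu.isMaximalRepeat_of_cons hN hau, rfl⟩, hend⟩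
  · rintro q - q' - z h h'
    exact Prod.ext (h.unique hT h').1 (h.unique hT h').2

/-! ### Size of the L-CDAWG -/

theorem V_finite_ncard_le (hT : T ≠ []) :
    (V T).Finite ∧ (V T).ncard ≤ (mu T + 1) + eLeft T := by
  have h1 := cdawgV_finite_ncard_le T
  have h2 := isType2_finite_ncard_le hT
  have hsub : V T ⊆ LNode.type1 '' cdawgV T ∪
      (fun q : CEdge A × ℕ => LNode.type2 q.1 q.2) '' {q | IsType2 T q.1 q.2} := by
    rintro v (⟨N, hN, rfl⟩ | ⟨e, k, h, rfl⟩)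
    · exact Or.inl ⟨N, hN, rfl⟩
    · exact Or.inr ⟨(e, k), h, rfl⟩
  have hfin := (h1.1.image LNode.type1).union
    (h2.1.image fun q : CEdge A × ℕ => LNode.type2 q.1 q.2)
  refine ⟨hfin.subset hsub, (Set.ncard_le_ncard hsub hfin).trans ((Set.ncard_union_le _ _).trans ?_)⟩
  exact add_le_add ((Set.ncard_image_le h1.1).trans h1.2) ((Set.ncard_image_le h2.1).trans h2.2)

theorem IsType2.pos_and_lt {e : CEdge A} {k : ℕ} (h : IsType2 T e k) :
    0 < k ∧ k < e.lab.length := by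
  obtain ⟨N, -, u, a, -, -, -, h1, h2, -⟩ := h
  exact ⟨h1, h2⟩

theorem IsPoint.le_length {e : CEdge A} {k : ℕ} {v : LNode A} (h : IsPoint T e k v) :
    k ≤ e.lab.length := by
  rcases h with ⟨rfl, -⟩ | ⟨rfl, -⟩ | ⟨h, -⟩
  · exact Nat.zero_le _
  · exact le_rfl
  · exact h.pos_and_lt.2.le

/-- Labels are non-empty, so the start, the end and the inner offsets of an edge are disjoint cases.
-/
theorem IsPoint.unique {e : CEdge A} (he : e ∈ cdawgE T) {k : ℕ} {v v' : LNode A}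
    (h : IsPoint T e k v) (h' : IsPoint T e k v') : v = v' := by
  have hpos := lab_length_pos he
  rcases h with ⟨hk, rfl⟩ | ⟨hk, rfl⟩ | ⟨h, rfl⟩ <;>
    rcases h' with ⟨hk', rfl⟩ | ⟨hk', rfl⟩ | ⟨h', rfl⟩ <;>
    first
    | rfl
    | omega
    | (have := h.pos_and_lt; omega)
    | (have := h'.pos_and_lt; omega)

theorem E_finite_ncard_le (hT : T ≠ []) :
    (E T).Finite ∧ (E T).ncard ≤ eRight T + eLeft T := by
  have h1 := cdawgE_finite_ncard_le T
  have h2 := isType2_finite_ncard_le hT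
  have hfin := (h1.1.image fun e : CEdge A => (e, 0)).union h2.1
  -- An L-CDAWG edge is related to its upper end `(e, i)`: either `i = 0`, counted by the CDAWG
  -- edges, or a type-2 point.
  refine (finite_and_ncard_le_of_rel (s := E T)
    (fun (f : LEdge A) (q : CEdge A × ℕ) => q.1 ∈ cdawgE T ∧ ∃ j, q.2 < j ∧
      IsPoint T q.1 q.2 f.hi ∧ IsPoint T q.1 j f.lo ∧
      (∀ k v, q.2 < k → k < j → ¬ IsPoint T q.1 k v) ∧
      q.1.lab[q.2]? = some f.char ∧ f.slen = j - q.2) hfin ?_ ?_).imp_right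
    fun h => h.trans ((Set.ncard_union_le _ _).trans
      (add_le_add ((Set.ncard_image_le h1.1).trans h1.2) h2.2))
  · rintro f ⟨e, he, i, j, hij, hi, hj, hbetween⟩
    refine ⟨(e, i), ?_, he, j, hij, hi, hj, hbetween⟩
    rcases hi with ⟨rfl, -⟩ | ⟨rfl, -⟩ | ⟨h, -⟩
    · exact Or.inl ⟨e, he, rfl⟩
    · exact absurd hj.le_length (by omega)
    · exact Or.inr h
  · rintro f - f' - ⟨e, i⟩ ⟨he, j, hij, hi, hj, hb, hc, hl⟩ ⟨-, j', hij', hi', hj', hb', hc', hl'⟩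
    -- Were the lower ends different, the nearer one would be a point strictly between the ends of
    -- the other edge.
    have hjj : j = j' := by
      rcases lt_trichotomy j j' with hlt | heq | hlt
      · exact absurd hj (hb' j _ hij hlt)
      · exact heq
      · exact absurd hj' (hb j' _ hij' hlt)
    subst hjj
    exact LEdge.ext (hi.unique he hi') (Option.some.inj (hc.symm.trans hc')) (hl.trans hl'.symm)
      (hj.unique he hj')

end Edges

end LCDAWG

theorem mainTheorem8 (σ : ℕ) :
    ∃ C : ℕ, ∀ (A : Type u) [Fintype A] [DecidableEq A], Fintype.card A = σ →
      ∀ T : List A, T ≠ [] →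
        (LCDAWG.V T).Finite ∧ (LCDAWG.E T).Finite ∧
        (LCDAWG.V T).ncard ≤ C * (LCDAWG.mu T + LCDAWG.eRight T) ∧
        (LCDAWG.E T).ncard ≤ C * LCDAWG.eRight T ∧
        LCDAWG.eLeft T ≤ σ * LCDAWG.eRight T := by
  -- The bounds are `mu T + 1 + σ * eRight T` for the nodes and `(1 + σ) * eRight T` for the edges;
  -- the stray `1` is absorbed because `1 ≤ mu T ≤ eRight T`, the empty string being a maximal
  -- repeat.
  refine ⟨σ + 1, fun A _ _ hA T hT => ?_⟩
  have hV := LCDAWG.V_finite_ncard_le hT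
  have hE := LCDAWG.E_finite_ncard_le hT
  have hmu := LCDAWG.one_le_mu hT
  have hle := LCDAWG.mu_le_eRight T
  have hleft : LCDAWG.eLeft T ≤ σ * LCDAWG.eRight T := by
    rw [← hA]
    exact (LCDAWG.eLeft_le_card_mul_mu T).trans (Nat.mul_le_mul_left _ hle)
  refine ⟨hV.1, hE.1, hV.2.trans ?_, hE.2.trans ?_, hleft⟩
  · nlinarith [Nat.zero_le (σ * LCDAWG.mu T)]
  · linarith
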